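/- Let $V$ be a finite set of $n$ points in the Euclidean plane in general position, i.e. no three points of $V$ are collinear. Let $D_V(n)$ be the graph whose vertices are the $\binom n2$ closed straight line segments joining two distinct points of $V$, two segments being adjacent if and only if they are disjoint. For a finite graph $G$, let the achromatic number $\alpha(G)$ be the largest $l$ for which there is a surjective map $\varsigma$ from the vertices of $G$ to $\{1,\dots,l\}$ that is proper (adjacent vertices get different colors) and complete (for any two different colors $i,j$ there is an edge $xy$ with $\varsigma(x)=i$ and $\varsigma(y)=j$). Then: 1. $\alpha(D_V(n))\ge \frac{n^2}{6}-\Theta(n)$; that is, there is an absolute constant $C>0$ such that for every natural number $n$ and every set $V$ of $n$ points in general position in the plane, $$\frac{n^2}{6}-Cn\le\alpha(D_V(n)).$$ 2. If $n\equiv 1$ or $3 \pmod 6$ and $V$ is a set of $n$ points in general position in the plane, then $$\frac{n^2}{6}-\frac n6=\frac13\binom n2\le\alpha(D_V(n)).$$ -/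

import Mathlib

namespace SegmentDisjointness

/-- The Euclidean plane. -/
abbrev Plane : Type := EuclideanSpace ℝ (Fin 2)

/-- A finite set of points in the plane is in general position if no three (distinct) points
of it are collinear. -/
def InGeneralPosition (V : Finset Plane) : Prop :=
  ∀ a ∈ V, ∀ b ∈ V, ∀ c ∈ V, a ≠ b → a ≠ c → b ≠ c → ¬ Collinear ℝ ({a, b, c} : Set Plane)

/-- The set of all (closed, nondegenerate) straight line segments with endpoints in `V`,
each segment being regarded as a set of points of the plane. -/
def segments (V : Finset Plane) : Set (Set Plane) :=
  {S | ∃ a ∈ V, ∃ b ∈ V, a ≠ b ∧ S = segment ℝ a b}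

theorem nonempty_of_mem_segments {V : Finset Plane} {S : Set Plane} (hS : S ∈ segments V) :
    S.Nonempty := by
  obtain ⟨a, _, b, _, _, rfl⟩ := hS
  exact ⟨a, left_mem_segment ℝ a b⟩

/-- The segment disjointness graph `D_V`: the vertices are the segments with endpoints in `V`,
and two segments are adjacent if and only if they are disjoint. -/
def disjointnessGraph (V : Finset Plane) : SimpleGraph (segments V) where
  Adj S T := Disjoint (S : Set Plane) (T : Set Plane)
  symm := ⟨fun _ _ h => h.symm⟩
  loopless := ⟨fun S h =>
    (nonempty_of_mem_segments S.property).ne_empty (disjoint_self.mp h)⟩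

/-- A colouring with colours `1, …, l` (a surjective function onto `Fin l`) is complete if for
each pair of different colours there is an edge whose ends have these colours. -/
def IsComplete {W : Type*} (G : SimpleGraph W) {l : ℕ} (c : W → Fin l) : Prop :=
  ∀ i j : Fin l, i ≠ j → ∃ x y : W, G.Adj x y ∧ c x = i ∧ c y = j

/-- The achromatic number of a finite graph: the largest `l` for which the graph has a proper
and complete `l`-colouring. (The set below is nonempty and bounded for a finite graph, so the
supremum is a maximum.) -/
noncomputable def achromaticNumber {W : Type*} (G : SimpleGraph W) : ℕ :=
  sSup {l : ℕ | ∃ c : W → Fin l, Function.Surjective c ∧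
    (∀ x y : W, G.Adj x y → c x ≠ c y) ∧ IsComplete G c}

end SegmentDisjointness

/-! Take triples of points of `V`, any two sharing at most one point. Give the three sides of each
triple one colour and every other segment its own. This is proper, since two sides of a triangle
meet. Colours of two triples `S`, `T` are always joined (`exists_disjoint_sides`): `T` has vertices
`c`, `d` outside `S`, the line `cd` misses `S` by general position, so two vertices of `S` lie on
one side of it and span a segment disjoint from `cd`. Merging colours as long as properness allows
gives a complete colouring and never identifies two triple colours. Steiner triple systems supply `m
* (m - 1) / 6` triples on `m` points: Bose's for `m ≡ 3`, Skolem's for `m ≡ 1` modulo 6. For other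
`n`, at most three points are dropped. -/

namespace SegmentDisjointness

/-! ### Complete colourings by merging colour classes. -/

/-- The bound for the achromatic number given by a proper colouring (with arbitrarily many
colours) in which the colours of a finite set `s` are pairwise joined by edges. -/
theorem card_le_achromaticNumber {W α : Type*} [Finite W] (G : SimpleGraph W) (c : W → α)
    (hc : ∀ x y, G.Adj x y → c x ≠ c y) (s : Finset α) (hs : ∀ i ∈ s, ∃ x, c x = i)
    (hadj : ∀ i ∈ s, ∀ j ∈ s, i ≠ j → ∃ x y, G.Adj x y ∧ c x = i ∧ c y = j) :
    s.card ≤ achromaticNumber G := by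
  classical
  -- A proper merge `g ∘ c` with the fewest colours is complete.
  let P : ℕ → Prop := fun m => ∃ g : α → α,
    (∀ x y, G.Adj x y → g (c x) ≠ g (c y)) ∧ (Set.range (g ∘ c)).ncard = m
  have hP : ∃ m, P m := ⟨_, id, hc, rfl⟩
  obtain ⟨g, hg, hm⟩ := Nat.find_spec hP
  have hmin : ∀ g' : α → α, (∀ x y, G.Adj x y → g' (c x) ≠ g' (c y)) →
      Nat.find hP ≤ (Set.range (g' ∘ c)).ncard := fun g' h => Nat.find_min' hP ⟨g', h, rfl⟩
  generalize Nat.find hP = m at hm hmin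
  have hfin : (Set.range (g ∘ c)).Finite := Set.finite_range _
  have hinj : Set.InjOn g s := by
    intro i hi j hj hij
    by_contra hne
    obtain ⟨x, y, hxy, rfl, rfl⟩ := hadj i hi j hj hne
    exact hg x y hxy hij
  have hcard : s.card ≤ m := by
    rw [← Set.ncard_coe_finset, ← Set.InjOn.ncard_image hinj, ← hm]
    refine Set.ncard_le_ncard ?_ hfin
    rintro _ ⟨i, hi, rfl⟩
    obtain ⟨x, rfl⟩ := hs i hi
    exact ⟨x, rfl⟩
  refine hcard.trans (le_csSup ?_ ?_)
  · refine ⟨Nat.card W, ?_⟩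
    rintro l ⟨f, hf, -⟩
    simpa using Nat.card_le_card_of_surjective f hf
  · have : Finite (Set.range (g ∘ c)) := hfin
    let e : Set.range (g ∘ c) ≃ Fin m := Finite.equivFinOfCardEq hm
    refine ⟨fun x => e ⟨g (c x), x, rfl⟩, ?_, ?_, ?_⟩
    · intro i
      obtain ⟨⟨_, x, rfl⟩, h⟩ := e.surjective i
      exact ⟨x, h⟩
    · intro x y hxy h
      exact hg x y hxy (congrArg Subtype.val (e.injective h))
    · intro i j hij
      obtain ⟨⟨_, x, rfl⟩, rfl⟩ := e.surjective i
      obtain ⟨⟨_, y, rfl⟩, rfl⟩ := e.surjective j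
      have hne : g (c x) ≠ g (c y) := fun h => hij (by simp [h])
      by_contra hcon
      have hno : ∀ x' y', G.Adj x' y' → g (c x') = g (c x) → g (c y') ≠ g (c y) := by
        intro x' y' h h1 h2
        exact hcon ⟨x', y', h, by simp [h1], by simp [h2]⟩
      -- Two unjoined classes can be merged, which contradicts minimality.
      let g' : α → α := fun a => if g a = g (c x) then g (c y) else g a
      have h1 := hmin g' (by
        intro x' y' h
        have := hg x' y' h
        have := hno x' y' h
        have := hno y' x' h.symm
        simp only [g']
        split_ifs <;> grind)
      have h2 : Set.range (g' ∘ c) ⊆ Set.range (g ∘ c) \ {g (c x)} := by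
        rintro _ ⟨z, rfl⟩
        simp only [g', Function.comp]
        split_ifs with h
        · exact ⟨⟨y, rfl⟩, hne.symm⟩
        · exact ⟨⟨z, rfl⟩, h⟩
      have h3 := Set.ncard_le_ncard h2 hfin.sdiff
      have h4 := Set.ncard_sdiff_singleton_lt_of_mem
        (show g (c x) ∈ Set.range (g ∘ c) from ⟨x, rfl⟩) hfin
      omega

/-! ### Plane geometry of segments. -/

/-- The doubled signed area of the triangle with vertices `c`, `d`, `x`. -/
def signedArea (c d x : Plane) : ℝ :=
  (d 0 - c 0) * (x 1 - c 1) - (d 1 - c 1) * (x 0 - c 0)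

theorem signedArea_combo (c d u v : Plane) {s t : ℝ} (h : s + t = 1) :
    signedArea c d (s • u + t • v) = s * signedArea c d u + t * signedArea c d v := by
  obtain rfl : s = 1 - t := by linarith
  simp [signedArea]
  ring

theorem collinear_of_signedArea_eq_zero {c d x : Plane} (hcd : c ≠ d)
    (h : signedArea c d x = 0) : Collinear ℝ ({c, d, x} : Set Plane) := by
  rw [collinear_iff_of_mem (p₀ := c) (by simp)]
  have hx : ∃ r : ℝ, x = r • (d - c) + c := by
    unfold signedArea at h
    by_cases h0 : d 0 - c 0 = 0
    · have h1 : d 1 - c 1 ≠ 0 := by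
        intro h1
        apply hcd
        ext i
        fin_cases i
        · simp; linarith
        · simp; linarith
      refine ⟨(x 1 - c 1) / (d 1 - c 1), ?_⟩
      have h2 : x 0 - c 0 = 0 := by
        rw [h0] at h
        simpa [h1] using h
      ext i
      fin_cases i
      · simp [h0]; linarith
      · simp; field_simp; ring
    · refine ⟨(x 0 - c 0) / (d 0 - c 0), ?_⟩
      ext i
      fin_cases i
      · simp; field_simp; ring
      · simp; field_simp; linarith
  refine ⟨d - c, ?_⟩
  intro p hp
  simp only [Set.mem_insert_iff, Set.mem_singleton_iff] at hp
  rcases hp with rfl | rfl | rfl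
  · exact ⟨0, by simp⟩
  · exact ⟨1, by simp⟩
  · simpa using hx

/-- The signed area is affine in its last argument: it vanishes on `cd` and keeps a strict sign
along `uv`. -/
theorem disjoint_segment_of_signedArea_mul_pos {c d u v : Plane}
    (h : 0 < signedArea c d u * signedArea c d v) :
    Disjoint (segment ℝ u v) (segment ℝ c d) := by
  rw [Set.disjoint_left]
  rintro _ ⟨s, t, hs, ht, hst, rfl⟩ ⟨s', t', -, -, hst', h'⟩
  have h1 := signedArea_combo c d u v hst
  have h2 := signedArea_combo c d c d hst'
  rw [h', h1] at h2
  have h3 : signedArea c d c = 0 := by simp [signedArea]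
  have h4 : signedArea c d d = 0 := by simp [signedArea]; ring
  rw [h3, h4] at h2
  rcases mul_pos_iff.mp h with ⟨hu, hv⟩ | ⟨hu, hv⟩ <;>
  · rcases hs.eq_or_lt with rfl | hs
    · nlinarith
    · nlinarith

theorem InGeneralPosition.signedArea_ne_zero {V : Finset Plane} (hV : InGeneralPosition V)
    {c d x : Plane} (hc : c ∈ V) (hd : d ∈ V) (hx : x ∈ V) (hcd : c ≠ d) (hcx : c ≠ x)
    (hdx : d ≠ x) : signedArea c d x ≠ 0 := fun h =>
  hV c hc d hd x hx hcd hcx hdx (collinear_of_signedArea_eq_zero hcd h)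

/-- Graph vertices are bare point sets; this recovers their endpoints in `V`. -/
theorem InGeneralPosition.eq_or_eq_of_mem_segment {V : Finset Plane} (hV : InGeneralPosition V)
    {a b x : Plane} (ha : a ∈ V) (hb : b ∈ V) (hx : x ∈ V) (hab : a ≠ b)
    (h : x ∈ segment ℝ a b) : x = a ∨ x = b := by
  by_contra! hne
  refine hV a ha b hb x hx hab hne.1.symm hne.2.symm ?_
  have h1 : Collinear ℝ ({a, x, b} : Set Plane) := Wbtw.collinear (mem_segment_iff_wbtw.mp h)
  rwa [Set.pair_comm x b] at h1

/-- Two triples of points with at most one common point span triangles with disjoint sides. -/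
theorem InGeneralPosition.exists_disjoint_sides {V : Finset Plane} (hV : InGeneralPosition V)
    {S T : Finset Plane} (hS : S ⊆ V) (hT : T ⊆ V) (hScard : S.card = 3) (hTcard : T.card = 3)
    (hST : ∀ a ∈ S, ∀ b ∈ S, a ∈ T → b ∈ T → a = b) :
    ∃ a ∈ S, ∃ b ∈ S, ∃ c ∈ T, ∃ d ∈ T, a ≠ b ∧ c ≠ d ∧
      Disjoint (segment ℝ a b) (segment ℝ c d) := by
  classical
  have h1 : (S ∩ T).card ≤ 1 := by
    rw [Finset.card_le_one]
    intro a ha b hb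
    rw [Finset.mem_inter] at ha hb
    exact hST a ha.1 b hb.1 ha.2 hb.2
  have h2 : 1 < (T \ S).card := by
    rw [Finset.card_sdiff]
    omega
  obtain ⟨c, hc, d, hd, hcd⟩ := Finset.one_lt_card.mp h2
  rw [Finset.mem_sdiff] at hc hd
  have h3 : ∀ x ∈ S, signedArea c d x ≠ 0 := fun x hx =>
    hV.signedArea_ne_zero (hT hc.1) (hT hd.1) (hS hx) hcd (by rintro rfl; exact hc.2 hx)
      (by rintro rfl; exact hd.2 hx)
  obtain ⟨p, q, r, hpq, hpr, hqr, rfl⟩ := Finset.card_eq_three.mp hScard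
  have key : ∀ u ∈ ({p, q, r} : Finset Plane), ∀ v ∈ ({p, q, r} : Finset Plane), u ≠ v →
      0 < signedArea c d u * signedArea c d v → ∃ a ∈ ({p, q, r} : Finset Plane),
      ∃ b ∈ ({p, q, r} : Finset Plane), ∃ c ∈ T, ∃ d ∈ T, a ≠ b ∧ c ≠ d ∧
      Disjoint (segment ℝ a b) (segment ℝ c d) := fun u hu v hv huv h =>
    ⟨u, hu, v, hv, c, hc.1, d, hd.1, huv, hcd, disjoint_segment_of_signedArea_mul_pos h⟩
  -- Of three nonzero signs, two agree.
  rcases (h3 p (by simp)).lt_or_gt with hp | hp <;>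
  rcases (h3 q (by simp)).lt_or_gt with hq | hq <;>
  rcases (h3 r (by simp)).lt_or_gt with hr | hr <;>
  first
  | exact key p (by simp) q (by simp) hpq (by nlinarith)
  | exact key p (by simp) r (by simp) hpr (by nlinarith)
  | exact key q (by simp) r (by simp) hqr (by nlinarith)

/-! ### Colouring segments by triples. -/

theorem finite_segments (V : Finset Plane) : (segments V).Finite := by
  refine ((V ×ˢ V).finite_toSet.image fun p => segment ℝ p.1 p.2).subset ?_
  rintro _ ⟨a, ha, b, hb, -, rfl⟩
  exact ⟨(a, b), by simp [ha, hb], rfl⟩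

/-- A packing of triples of points gives a lower bound for the achromatic number. -/
theorem InGeneralPosition.card_le_achromaticNumber {V : Finset Plane}
    (hV : InGeneralPosition V) (B : Finset (Finset Plane)) (hBV : ∀ T ∈ B, T ⊆ V)
    (hB3 : ∀ T ∈ B, T.card = 3)
    (hB : ∀ S ∈ B, ∀ T ∈ B, ∀ a ∈ S, ∀ b ∈ S, a ∈ T → b ∈ T → a ≠ b → S = T) :
    B.card ≤ achromaticNumber (disjointnessGraph V) := by
  classical
  have : Finite (segments V) := finite_segments V
  let R : segments V → Finset Plane → Prop := fun S T =>
    T ∈ B ∧ ∃ a ∈ T, ∃ b ∈ T, a ≠ b ∧ (S : Set Plane) = segment ℝ a b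
  have hR : ∀ S T T', R S T → R S T' → T = T' := by
    rintro S T T' ⟨hT, a, ha, b, hb, hab, hS⟩ ⟨hT', a', ha', b', hb', hab', hS'⟩
    have hmem : ∀ x ∈ V, x ∈ segment ℝ a' b' → x ∈ T' := by
      intro x hx h
      rcases hV.eq_or_eq_of_mem_segment (hBV T' hT' ha') (hBV T' hT' hb') hx hab' h with
        rfl | rfl <;> assumption
    rw [hS] at hS'
    exact hB T hT T' hT' a ha b hb (hmem a (hBV T hT ha) (hS' ▸ left_mem_segment ℝ a b))
      (hmem b (hBV T hT hb) (hS' ▸ right_mem_segment ℝ a b)) hab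
  let c : segments V → Finset Plane ⊕ segments V := fun S =>
    if h : ∃ T, R S T then Sum.inl h.choose else Sum.inr S
  have hc : ∀ S T, R S T → c S = Sum.inl T := by
    intro S T h
    have h' : ∃ T, R S T := ⟨T, h⟩
    simp only [c, dif_pos h']
    rw [hR S _ T h'.choose_spec h]
  have hc' : ∀ S T, c S = Sum.inl T → R S T := by
    intro S T h
    simp only [c] at h
    split_ifs at h with h'
    have := h'.choose_spec
    rw [Sum.inl.inj h] at this
    exact this
  have hside : ∀ T ∈ B, ∀ a ∈ T, ∀ b ∈ T, a ≠ b →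
      ∃ S : segments V, (S : Set Plane) = segment ℝ a b ∧ c S = Sum.inl T := by
    intro T hT a ha b hb hab
    let S : segments V := ⟨segment ℝ a b, a, hBV T hT ha, b, hBV T hT hb, hab, rfl⟩
    exact ⟨S, rfl, hc S T ⟨hT, a, ha, b, hb, hab, rfl⟩⟩
  have := SegmentDisjointness.card_le_achromaticNumber (disjointnessGraph V) c ?_
    (B.map ⟨Sum.inl, Sum.inl_injective⟩) ?_ ?_
  · simpa using this
  · intro S S' hadj heq
    rcases h : c S with T | X
    · obtain ⟨hT, a, ha, b, hb, hab, hS⟩ := hc' S T h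
      obtain ⟨-, a', ha', b', hb', hab', hS'⟩ := hc' S' T (heq ▸ h)
      have hdis : Disjoint (S : Set Plane) (S' : Set Plane) := hadj
      rw [hS, hS', Set.disjoint_left] at hdis
      have h1 : a ≠ a' := by
        rintro rfl
        exact hdis (left_mem_segment ℝ a b) (left_mem_segment ℝ a b')
      have h2 : a ≠ b' := by
        rintro rfl
        exact hdis (left_mem_segment ℝ a b) (right_mem_segment ℝ a' a)
      have h3 : b ≠ a' := by
        rintro rfl
        exact hdis (right_mem_segment ℝ a b) (left_mem_segment ℝ b b')
      have h4 : b ≠ b' := by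
        rintro rfl
        exact hdis (right_mem_segment ℝ a b) (right_mem_segment ℝ a' b)
      -- Disjoint sides would need four distinct endpoints in a triple.
      have h5 : ({a, b, a', b'} : Finset Plane) ⊆ T := by
        simp [Finset.insert_subset_iff, ha, hb, ha', hb']
      have h6 := Finset.card_le_card h5
      rw [hB3 T hT] at h6
      have h7 : ({a, b, a', b'} : Finset Plane).card = 4 := by
        rw [Finset.card_insert_of_notMem (by simp [hab, h1, h2]),
          Finset.card_insert_of_notMem (by simp [h3, h4]), Finset.card_pair hab']
      omega
    · have h' := h
      rw [heq] at h'
      simp only [c] at h h'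
      split_ifs at h h'
      have : S = S' := (Sum.inr.inj h).trans (Sum.inr.inj h').symm
      exact (disjointnessGraph V).loopless.irrefl S (this ▸ hadj)
  · intro i hi
    simp only [Finset.mem_map, Function.Embedding.coeFn_mk] at hi
    obtain ⟨T, hT, rfl⟩ := hi
    obtain ⟨a, ha, b, hb, hab⟩ := Finset.one_lt_card.mp (by rw [hB3 T hT]; norm_num : 1 < T.card)
    obtain ⟨S, -, hS⟩ := hside T hT a ha b hb hab
    exact ⟨S, hS⟩
  · intro i hi j hj hij
    simp only [Finset.mem_map, Function.Embedding.coeFn_mk] at hi hj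
    obtain ⟨T, hT, rfl⟩ := hi
    obtain ⟨T', hT', rfl⟩ := hj
    obtain ⟨a, ha, b, hb, d, hd, e, he, hab, hde, hdis⟩ :=
      hV.exists_disjoint_sides (hBV T hT) (hBV T' hT') (hB3 T hT) (hB3 T' hT') (by
        intro a ha b hb ha' hb'
        by_contra hab
        exact hij (congrArg _ (hB T hT T' hT' a ha b hb ha' hb' hab)))
    obtain ⟨S, hS, hcS⟩ := hside T hT a ha b hb hab
    obtain ⟨S', hS', hcS'⟩ := hside T' hT' d hd e he hde
    refine ⟨S, S', ?_, hcS, hcS'⟩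
    change Disjoint (S : Set Plane) (S' : Set Plane)
    rwa [hS, hS']

/-! ### Steiner quasigroups and triple systems. -/

/-- A binary operation of a Steiner quasigroup: `op a b` is the third point of the block
through two different points `a` and `b`. -/
structure IsSteinerOp {ι : Type*} (op : ι → ι → ι) : Prop where
  idem : ∀ a, op a a = a
  comm : ∀ a b, op a b = op b a
  cancel : ∀ a b, op a (op a b) = b

namespace IsSteinerOp

variable {ι : Type*} {op : ι → ι → ι}

theorem ne_left (h : IsSteinerOp op) {a b : ι} (hab : a ≠ b) : op a b ≠ a := fun h' =>
  hab (by rw [← h.cancel a b, h', h.idem])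

theorem ne_right (h : IsSteinerOp op) {a b : ι} (hab : a ≠ b) : op a b ≠ b := by
  rw [h.comm]
  exact h.ne_left hab.symm

/-- By `comm` and `cancel`, the product of any two of `a`, `b`, `op a b` is the third. -/
theorem block_eq [DecidableEq ι] (h : IsSteinerOp op) {a b x y : ι} (hxy : x ≠ y)
    (hx : x ∈ ({a, b, op a b} : Finset ι)) (hy : y ∈ ({a, b, op a b} : Finset ι)) :
    ({a, b, op a b} : Finset ι) = {x, y, op x y} := by
  have h1 := h.comm a b
  have h2 := h.cancel a b
  have h3 := h.cancel b a
  have h4 := h.comm a (op a b)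
  have h5 := h.comm b (op a b)
  simp only [Finset.mem_insert, Finset.mem_singleton] at hx hy
  ext z
  simp only [Finset.mem_insert, Finset.mem_singleton]
  rcases hx with rfl | rfl | rfl <;> rcases hy with rfl | rfl | rfl <;> grind

/-- The blocks of a Steiner quasigroup form a Steiner triple system. -/
theorem exists_blocks [Fintype ι] [DecidableEq ι] (h : IsSteinerOp op) :
    ∃ B : Finset (Finset ι), 6 * B.card = Fintype.card ι * (Fintype.card ι - 1) ∧
      (∀ T ∈ B, T.card = 3) ∧
      ∀ S ∈ B, ∀ T ∈ B, ∀ a ∈ S, ∀ b ∈ S, a ∈ T → b ∈ T → a ≠ b → S = T := by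
  let f : ι × ι → Finset ι := fun p => {p.1, p.2, op p.1 p.2}
  let D : Finset (ι × ι) := Finset.univ.offDiag
  have h3 : ∀ T ∈ D.image f, T.card = 3 := by
    intro T hT
    obtain ⟨⟨a, b⟩, hab, rfl⟩ := Finset.mem_image.mp hT
    have hab : a ≠ b := by simpa [D] using hab
    exact Finset.card_eq_three.mpr
      ⟨a, b, op a b, hab, (h.ne_left hab).symm, (h.ne_right hab).symm, rfl⟩
  have heq : ∀ T ∈ D.image f, ∀ x ∈ T, ∀ y ∈ T, x ≠ y → T = f (x, y) := by
    intro T hT x hx y hy hxy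
    obtain ⟨⟨a, b⟩, -, rfl⟩ := Finset.mem_image.mp hT
    exact h.block_eq hxy hx hy
  refine ⟨D.image f, ?_, h3, ?_⟩
  -- Double counting: each block arises from its 6 ordered pairs of distinct points.
  · have h1 := Finset.card_eq_sum_card_fiberwise (s := D) (t := D.image f) (f := f)
      (fun p hp => Finset.mem_image_of_mem f hp)
    have h2 : ∀ T ∈ D.image f, (D.filter fun p => f p = T).card = 6 := by
      intro T hT
      have : (D.filter fun p => f p = T) = T.offDiag := by
        ext ⟨x, y⟩
        simp only [D, Finset.mem_filter, Finset.mem_offDiag, Finset.mem_univ, true_and]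
        constructor
        · rintro ⟨hxy, rfl⟩
          simp [f, hxy]
        · rintro ⟨hx, hy, hxy⟩
          exact ⟨hxy, (heq T hT x hx y hy hxy).symm⟩
      rw [this, Finset.offDiag_card, h3 T hT]
    rw [Finset.sum_congr rfl h2, Finset.sum_const, smul_eq_mul, Finset.offDiag_card,
      Finset.card_univ] at h1
    rw [mul_comm, ← h1, Nat.mul_sub, mul_one]
  · intro S hS T hT a ha b hb ha' hb' hab
    rw [heq S hS a ha b hb hab, heq T hT a ha' b hb' hab]

end IsSteinerOp

/-! ### The constructions of Bose and Skolem. -/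

theorem zmod_three_cases (i j : ZMod 3) : j = i ∨ j = i + 1 ∨ i = j + 1 := by
  revert i j
  decide

theorem zmod_three_add_one_ne (i : ZMod 3) : i + 1 ≠ i := by
  revert i
  decide

theorem zmod_three_ne_add_one (i : ZMod 3) : i ≠ i + 1 := by
  revert i
  decide

theorem zmod_three_ne_add_one_add_one (i : ZMod 3) : i ≠ i + 1 + 1 := by
  revert i
  decide

theorem zmod_three_add_one_add_one_ne (i : ZMod 3) : i + 1 + 1 ≠ i := by
  revert i
  decide

theorem zmod_three_add_one_add_one_add_one (i : ZMod 3) : i + 1 + 1 + 1 = i := by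
  revert i
  decide

/-- The operation of Bose's triple system on `Q × ZMod 3`; `h` is the inverse of `2` in `Q`. -/
def boseOp {Q : Type*} [CommRing Q] [DecidableEq Q] (h : Q) (a b : Q × ZMod 3) : Q × ZMod 3 :=
  if b.2 = a.2 then
    if a.1 = b.1 then a else (h * (a.1 + b.1), a.2 + 1)
  else if b.2 = a.2 + 1 then
    if a.1 = b.1 then (a.1, a.2 + 1 + 1) else (2 * b.1 - a.1, a.2)
  else if a.1 = b.1 then (a.1, a.2 + 1) else (2 * a.1 - b.1, b.2)

/-- The blocks are the columns over each `x` and `{(x, i), (y, i), (h * (x + y), i + 1)}` for `x ≠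
y`. Midpoints form an idempotent commutative quasigroup; reflection recovers a missing endpoint. -/
theorem isSteinerOp_boseOp {Q : Type*} [CommRing Q] [DecidableEq Q] {h : Q} (hh : 2 * h = 1) :
    IsSteinerOp (boseOp h) := by
  have half_eq : ∀ x y : Q, x = h * (x + y) ↔ x = y := by
    intro x y
    constructor
    · intro H
      linear_combination 2 * H + (x + y) * hh
    · rintro rfl
      linear_combination -x * hh
  have refl_eq : ∀ x y : Q, x = 2 * y - x ↔ x = y := by
    intro x y
    constructor
    · intro H
      linear_combination h * H + (y - x) * hh
    · rintro rfl
      ring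
  have refl_eq' : ∀ x y : Q, x = 2 * x - y ↔ x = y := by
    intro x y
    constructor
    · intro H
      linear_combination -H
    · rintro rfl
      ring
  have refl_half : ∀ x y : Q, 2 * (h * (x + y)) - x = y := by
    intro x y
    linear_combination (x + y) * hh
  have half_two : ∀ y : Q, h * (2 * y) = y := by
    intro y
    linear_combination y * hh
  refine ⟨?_, ?_, ?_⟩
  · simp [boseOp]
  · rintro ⟨x, i⟩ ⟨y, j⟩
    rcases zmod_three_cases i j with rfl | rfl | rfl <;> by_cases hxy : x = y <;>
      simp [boseOp, hxy, Ne.symm, zmod_three_ne_add_one_add_one,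
        add_comm x y]
  · rintro ⟨x, i⟩ ⟨y, j⟩
    rcases zmod_three_cases i j with rfl | rfl | rfl <;> by_cases hxy : x = y <;>
      simp [boseOp, hxy, zmod_three_ne_add_one_add_one,
        zmod_three_add_one_add_one_ne, zmod_three_add_one_add_one_add_one,
        half_eq, refl_eq, refl_eq', refl_half, half_two]

/-- The operation of Skolem's triple system on `Q × ZMod 3` with a point at infinity.
`L` singles out half of the elements of the group `Q`, the involution `τ` exchanges this half
and the other one, and `d` is the inverse of the diagonal of a half-idempotent quasigroup. -/
def skolemOp {Q : Type*} [AddCommGroup Q] [DecidableEq Q] (L : Q → Prop) [DecidablePred L]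
    (τ : Q → Q) (d : Q ≃ Q) : Option (Q × ZMod 3) → Option (Q × ZMod 3) → Option (Q × ZMod 3)
  | none, none => none
  | none, some (x, i) => if L x then some (τ x, i + 1 + 1) else some (τ x, i + 1)
  | some (x, i), none => if L x then some (τ x, i + 1 + 1) else some (τ x, i + 1)
  | some (x, i), some (y, j) =>
    if j = i then
      if x = y then some (x, i) else some (d.symm (x + y), i + 1)
    else if j = i + 1 then
      if x = y ∧ L y then some (x, i + 1 + 1)
      else if x = τ y ∧ L y then none
      else some (d y - x, i)
    else
      if y = x ∧ L x then some (x, i + 1)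
      else if y = τ x ∧ L x then none
      else some (d x - y, j)

/-- The blocks are `{(x, i), (y, i), (d.symm (x + y), i + 1)}` for `x ≠ y`, the columns over `x`
with `L x`, and `{∞, (τ y, i), (y, i + 1)}` with `L y`. The first kind misses exactly the pairs `(x,
i)`, `(z, i + 1)` with `d z = x + x`; by `hd` these are the ones covered by the other two kinds. -/
theorem isSteinerOp_skolemOp {Q : Type*} [AddCommGroup Q] [DecidableEq Q] {L : Q → Prop}
    [DecidablePred L] {τ : Q → Q} {d : Q ≃ Q} (hτ : ∀ x, τ (τ x) = x)
    (hL : ∀ x, L (τ x) ↔ ¬ L x) (hd : ∀ x z, d z = x + x ↔ L z ∧ (x = z ∨ x = τ z)) :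
    IsSteinerOp (skolemOp L τ d) := by
  have hne : ∀ x, τ x ≠ x := fun x h => by
    have := hL x
    rw [h] at this
    tauto
  have hdiff : ∀ x z, x = d z - x ↔ L z ∧ (x = z ∨ x = τ z) := by
    intro x z
    rw [← hd, eq_sub_iff_add_eq, eq_comm]
  have hswap : ∀ x z, d x - (d x - z) = z := by
    intro x z
    abel
  have hsum : ∀ x y, x ≠ y → ¬ (x = d.symm (x + y) ∧ L (d.symm (x + y))) := by
    rintro x y hxy ⟨h1, h2⟩
    have := (hd x _).mpr ⟨h2, Or.inl h1⟩
    simp at this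
    exact hxy this.symm
  have hsum' : ∀ x y, x ≠ y → ¬ (x = τ (d.symm (x + y)) ∧ L (d.symm (x + y))) := by
    rintro x y hxy ⟨h1, h2⟩
    have := (hd x _).mpr ⟨h2, Or.inr h1⟩
    simp at this
    exact hxy this.symm
  have hlow : ∀ x z, ¬ (x = z ∧ L z) → ¬ (x = τ z ∧ L z) → x ≠ d z - x := by
    intro x z h1 h2 h3
    rw [hdiff] at h3
    tauto
  have hsub : ∀ x z, ¬ (x = z ∧ L z) → ¬ (x = τ z ∧ L z) →
      ¬ (d z - x = z ∧ L z) ∧ ¬ (d z - x = τ z ∧ L z) := by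
    intro x z h1 h2
    constructor
    · rintro ⟨h3, h4⟩
      have := (hd z z).mpr ⟨h4, Or.inl rfl⟩
      apply h1
      rw [this, sub_eq_iff_eq_add, add_right_inj] at h3
      exact ⟨h3.symm, h4⟩
    · rintro ⟨h3, h4⟩
      have := (hd (τ z) z).mpr ⟨h4, Or.inr rfl⟩
      apply h2
      rw [this, sub_eq_iff_eq_add, add_right_inj] at h3
      exact ⟨h3.symm, h4⟩
  refine ⟨?_, ?_, ?_⟩
  · rintro (_ | ⟨x, i⟩) <;> simp [skolemOp]
  · rintro (_ | ⟨x, i⟩) (_ | ⟨y, j⟩)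
    · rfl
    · rfl
    · rfl
    · rcases zmod_three_cases i j with rfl | rfl | rfl
      · by_cases hxy : x = y
        · simp [skolemOp, hxy]
        · simp [skolemOp, hxy, Ne.symm hxy, add_comm x y]
      · simp [skolemOp, zmod_three_ne_add_one_add_one]
        grind
      · simp [skolemOp, zmod_three_ne_add_one_add_one]
        grind
  · rintro (_ | ⟨x, i⟩) (_ | ⟨y, j⟩)
    · rfl
    · by_cases hy : L y <;>
        simp [skolemOp, hy, hL, hτ, zmod_three_add_one_add_one_add_one]
    · by_cases hx : L x
      · simp [skolemOp, hx, hne, zmod_three_add_one_add_one_ne]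
      · simp [skolemOp, hx, hL, hτ, (hne x).symm]
    · rcases zmod_three_cases i j with rfl | rfl | rfl
      · by_cases hxy : x = y
        · simp [skolemOp, hxy]
        · simp only [skolemOp, hxy, if_true, if_false, zmod_three_add_one_ne, hsum x y hxy,
            hsum' x y hxy]
          simp
      · by_cases h1 : x = y ∧ L y
        · obtain ⟨rfl, h1⟩ := h1
          simp [skolemOp, h1, zmod_three_add_one_add_one_ne]
        · by_cases h2 : x = τ y ∧ L y
          · obtain ⟨rfl, h2⟩ := h2
            simp [skolemOp, h2, hne, hL, hτ]
          · simp only [skolemOp, zmod_three_add_one_ne, if_true, if_false, if_neg h1, if_neg h2,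
              if_neg (hlow x y h1 h2)]
            simp
      · by_cases h1 : y = x ∧ L x
        · obtain ⟨rfl, h1⟩ := h1
          simp [skolemOp, h1, zmod_three_ne_add_one_add_one,
            zmod_three_add_one_add_one_add_one]
        · by_cases h2 : y = τ x ∧ L x
          · obtain ⟨rfl, h2⟩ := h2
            simp [skolemOp, h2, hne, zmod_three_ne_add_one_add_one,
              zmod_three_add_one_add_one_add_one]
          · obtain ⟨h3, h4⟩ := hsub y x h1 h2
            simp only [skolemOp, zmod_three_ne_add_one, zmod_three_ne_add_one_add_one,
              if_false, if_neg h1, if_neg h2, if_neg h3, if_neg h4, hswap]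

theorem IsSteinerOp.card_mul_le_achromaticNumber {ι : Type*} [Fintype ι] [DecidableEq ι]
    {op : ι → ι → ι} (h : IsSteinerOp op) {V : Finset Plane} (hV : InGeneralPosition V)
    (hcard : Fintype.card ι ≤ V.card) :
    Fintype.card ι * (Fintype.card ι - 1) ≤ 6 * achromaticNumber (disjointnessGraph V) := by
  obtain ⟨B, hB, hB3, hBB⟩ := h.exists_blocks
  obtain ⟨f⟩ : Nonempty (ι ↪ V) := Function.Embedding.nonempty_of_card_le (by simpa using hcard)
  let e : ι ↪ Plane := f.trans (Function.Embedding.subtype _)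
  rw [← hB]
  refine Nat.mul_le_mul_left 6 ?_
  have := hV.card_le_achromaticNumber (B.map (Finset.mapEmbedding e).toEmbedding) ?_ ?_ ?_
  · simpa using this
  · intro T hT
    obtain ⟨S, -, rfl⟩ := Finset.mem_map.mp hT
    intro x hx
    obtain ⟨i, -, rfl⟩ := Finset.mem_map.mp (show x ∈ S.map e from hx)
    exact (f i).2
  · intro T hT
    obtain ⟨S, hS, rfl⟩ := Finset.mem_map.mp hT
    exact (Finset.card_map e).trans (hB3 S hS)
  · intro S hS T hT a ha b hb ha' hb' hab
    obtain ⟨S', hS', rfl⟩ := Finset.mem_map.mp hS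
    obtain ⟨T', hT', rfl⟩ := Finset.mem_map.mp hT
    obtain ⟨i, hi, rfl⟩ := Finset.mem_map.mp (show a ∈ S'.map e from ha)
    obtain ⟨j, hj, rfl⟩ := Finset.mem_map.mp (show b ∈ S'.map e from hb)
    have hi' : i ∈ T' := (Finset.mem_map' e).mp ha'
    have hj' : j ∈ T' := (Finset.mem_map' e).mp hb'
    rw [hBB S' hS' T' hT' i hi j hj hi' hj' (fun h => hab (by rw [h]))]

/-! ### Skolem's data on `ZMod (2 * k)`, computed on representatives. -/

/-- The inverse of the diagonal of the half-idempotent quasigroup on `ZMod (2 * k)`. -/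
def skolemDiag (k : ℕ) (z : ZMod (2 * k)) : ZMod (2 * k) :=
  z + z + if z.val < k then 0 else 1

theorem zmod_exists_natCast {n : ℕ} [NeZero n] (x : ZMod n) :
    ∃ a : ℕ, a < n ∧ x = a :=
  ⟨x.val, x.val_lt, (ZMod.natCast_zmod_val x).symm⟩

theorem zmod_natCast_inj {n a b : ℕ} (ha : a < n) (hb : b < n) :
    (a : ZMod n) = b ↔ a = b := by
  rw [ZMod.natCast_eq_natCast_iff', Nat.mod_eq_of_lt ha, Nat.mod_eq_of_lt hb]

theorem zmod_two_mul_add_self {k a : ℕ} :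
    (a : ZMod (2 * k)) + a = (if a < k then 2 * a else 2 * a - 2 * k : ℕ) := by
  split_ifs with h
  · push_cast
    ring
  · rw [Nat.cast_sub (by omega), ZMod.natCast_self]
    push_cast
    ring

theorem skolemDiag_natCast {k a : ℕ} (ha : a < 2 * k) :
    skolemDiag k a = (if a < k then 2 * a else 2 * a - 2 * k + 1 : ℕ) := by
  rw [skolemDiag, ZMod.val_natCast_of_lt ha, zmod_two_mul_add_self]
  split_ifs <;> simp

theorem zmod_two_mul_natCast_add {k a : ℕ} :
    (a : ZMod (2 * k)) + k = (if a < k then a + k else a - k : ℕ) := by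
  split_ifs with h
  · push_cast
    rfl
  · rw [Nat.cast_sub (by omega), sub_eq_add_neg, add_right_inj, eq_neg_iff_add_eq_zero,
      ← Nat.cast_add, ← two_mul, ZMod.natCast_self]

/-- The lower half maps to the even residues, the upper half to the odd ones. -/
theorem skolemDiag_injective (k : ℕ) [NeZero (2 * k)] : Function.Injective (skolemDiag k) := by
  intro x y h
  obtain ⟨a, ha, rfl⟩ := zmod_exists_natCast x
  obtain ⟨b, hb, rfl⟩ := zmod_exists_natCast y
  rw [skolemDiag_natCast ha, skolemDiag_natCast hb,
    zmod_natCast_inj (by split_ifs <;> omega) (by split_ifs <;> omega)] at h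
  rw [zmod_natCast_inj ha hb]
  split_ifs at h <;> omega

theorem exists_isSteinerOp_skolem (k : ℕ) [NeZero (2 * k)] :
    ∃ op : Option (ZMod (2 * k) × ZMod 3) → Option (ZMod (2 * k) × ZMod 3) →
      Option (ZMod (2 * k) × ZMod 3), IsSteinerOp op := by
  refine ⟨_, isSteinerOp_skolemOp (L := fun z : ZMod (2 * k) => z.val < k)
    (τ := fun z => z + k) (d := Equiv.ofBijective (skolemDiag k)
      (Finite.injective_iff_bijective.mp (skolemDiag_injective k))) ?_ ?_ ?_⟩
  · intro x
    have h : (k : ZMod (2 * k)) + k = 0 := by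
      rw [← Nat.cast_add, ← two_mul, ZMod.natCast_self]
    rw [add_assoc, h, add_zero]
  · intro x
    obtain ⟨a, ha, rfl⟩ := zmod_exists_natCast x
    rw [zmod_two_mul_natCast_add, ZMod.val_natCast_of_lt ha,
      ZMod.val_natCast_of_lt (by split_ifs <;> omega)]
    split_ifs <;> omega
  -- `x + x` is even, so `z` is in the lower half; then `2x = 2z` modulo `2k` leaves `x = z` or `x =
  -- z + k`.
  · intro x z
    obtain ⟨a, ha, rfl⟩ := zmod_exists_natCast x
    obtain ⟨b, hb, rfl⟩ := zmod_exists_natCast z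
    rw [Equiv.ofBijective_apply, skolemDiag_natCast hb, zmod_two_mul_add_self,
      zmod_two_mul_natCast_add, ZMod.val_natCast_of_lt hb, zmod_natCast_inj ha hb,
      zmod_natCast_inj ha (by split_ifs <;> omega),
      zmod_natCast_inj (by split_ifs <;> omega) (by split_ifs <;> omega)]
    split_ifs <;> omega

theorem exists_isSteinerOp_bose (k : ℕ) :
    ∃ op : ZMod (2 * k + 1) × ZMod 3 → ZMod (2 * k + 1) × ZMod 3 → ZMod (2 * k + 1) × ZMod 3,
      IsSteinerOp op := by
  -- `2 * (k + 1) = 1` modulo `2 * k + 1`.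
  refine ⟨_, isSteinerOp_boseOp (h := ((k + 1 : ℕ) : ZMod (2 * k + 1))) ?_⟩
  have h : ((2 * k + 1 : ℕ) : ZMod (2 * k + 1)) = 0 := ZMod.natCast_self _
  push_cast at h ⊢
  linear_combination h

/-! ### The numerical bounds. -/

theorem InGeneralPosition.mul_le_achromaticNumber {V : Finset Plane} (hV : InGeneralPosition V)
    {m : ℕ} (hm : m % 6 = 1 ∨ m % 6 = 3) (hmV : m ≤ V.card) :
    m * (m - 1) ≤ 6 * achromaticNumber (disjointnessGraph V) := by
  rcases hm with hm | hm
  · obtain ⟨k, rfl⟩ : ∃ k, m = 6 * k + 1 := ⟨m / 6, by omega⟩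
    -- `ZMod 0` is infinite, so `m = 1` is separate; there the bound is trivial.
    rcases Nat.eq_zero_or_pos k with rfl | hk
    · simp
    · have : NeZero (2 * k) := ⟨by omega⟩
      obtain ⟨op, hop⟩ := exists_isSteinerOp_skolem k
      have hcard : Fintype.card (Option (ZMod (2 * k) × ZMod 3)) = 6 * k + 1 := by
        rw [Fintype.card_option, Fintype.card_prod, ZMod.card, ZMod.card]
        ring
      have := hop.card_mul_le_achromaticNumber hV (hcard.le.trans hmV)
      rwa [hcard] at this
  · obtain ⟨k, rfl⟩ : ∃ k, m = 6 * k + 3 := ⟨m / 6, by omega⟩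
    obtain ⟨op, hop⟩ := exists_isSteinerOp_bose k
    have hcard : Fintype.card (ZMod (2 * k + 1) × ZMod 3) = 6 * k + 3 := by
      rw [Fintype.card_prod, ZMod.card, ZMod.card]
      ring
    have := hop.card_mul_le_achromaticNumber hV (hcard.le.trans hmV)
    rwa [hcard] at this

theorem InGeneralPosition.real_le_achromaticNumber {V : Finset Plane} (hV : InGeneralPosition V)
    {m : ℕ} (hm : m % 6 = 1 ∨ m % 6 = 3) (hmV : m ≤ V.card) :
    (m : ℝ) * (m - 1) ≤ 6 * (achromaticNumber (disjointnessGraph V) : ℝ) := by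
  have h := hV.mul_le_achromaticNumber hm hmV
  have h1 : ((m - 1 : ℕ) : ℝ) = m - 1 := Nat.cast_pred (by omega)
  rw [← h1]
  exact_mod_cast h

end SegmentDisjointness

theorem mainTheorem4 :
    (∃ C : ℝ, 0 < C ∧
      ∀ (n : ℕ) (V : Finset SegmentDisjointness.Plane), V.card = n →
        SegmentDisjointness.InGeneralPosition V →
        (n : ℝ) ^ 2 / 6 - C * (n : ℝ) ≤
          (SegmentDisjointness.achromaticNumber
            (SegmentDisjointness.disjointnessGraph V) : ℝ)) ∧
    (∀ (n : ℕ) (V : Finset SegmentDisjointness.Plane), V.card = n →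
        SegmentDisjointness.InGeneralPosition V → (n % 6 = 1 ∨ n % 6 = 3) →
        (n : ℝ) ^ 2 / 6 - (n : ℝ) / 6 = (1 / 3 : ℝ) * (n.choose 2 : ℝ) ∧
        (1 / 3 : ℝ) * (n.choose 2 : ℝ) ≤
          (SegmentDisjointness.achromaticNumber
            (SegmentDisjointness.disjointnessGraph V) : ℝ)) := by
  constructor
  -- With `m ≥ n - 3`, `m * (m - 1) ≥ (n - 3) * (n - 4) ≥ n ^ 2 - 7 * n`. The loss of three occurs
  -- for `n ≡ 0` modulo 6.
  · refine ⟨7 / 6, by norm_num, ?_⟩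
    rintro n V rfl hV
    by_cases hn : V.card < 3
    · have h0 : (0 : ℝ) ≤ SegmentDisjointness.achromaticNumber
          (SegmentDisjointness.disjointnessGraph V) := Nat.cast_nonneg _
      have h1 : (V.card : ℝ) ≤ 3 := by exact_mod_cast hn.le
      have h2 : (0 : ℝ) ≤ V.card := Nat.cast_nonneg _
      nlinarith
    · obtain ⟨m, hm, hmV, hVm⟩ : ∃ m, (m % 6 = 1 ∨ m % 6 = 3) ∧ m ≤ V.card ∧ V.card ≤ m + 3 := by
        by_cases h : V.card % 6 = 1 ∨ V.card % 6 = 2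
        · exact ⟨V.card - (V.card % 6 - 1), by omega, by omega, by omega⟩
        · by_cases h0 : V.card % 6 = 0
          · exact ⟨V.card - 3, by omega, by omega, by omega⟩
          · exact ⟨V.card - (V.card % 6 - 3), by omega, by omega, by omega⟩
      have h := hV.real_le_achromaticNumber hm hmV
      have h1 : (V.card : ℝ) ≤ m + 3 := by exact_mod_cast hVm
      have h2 : (1 : ℝ) ≤ m := by exact_mod_cast (show 1 ≤ m by omega)
      have h3 : (3 : ℝ) ≤ V.card := by exact_mod_cast not_lt.mp hn
      nlinarith
  · rintro n V rfl hV hn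
    have h := hV.real_le_achromaticNumber hn le_rfl
    rw [Nat.cast_choose_two]
    constructor
    · ring
    · linarith
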